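/- Let $T$ be a tetrahedron in $\mathbb{R}^3$ with vertices $v_1,\dots,v_4$ (the four faces are non-degenerate triangles; the flat case of a doubly covered quadrilateral is allowed). The curvature of $T$ at a vertex is $2\pi$ minus the sum of the three face angles at that vertex, and $T$ is called isosceles if the curvature at each of its four vertices equals $\pi$. A closed quasigeodesic on the surface of $T$ is a closed polygonal curve on the surface (a closed curve of positive length consisting of finitely many straight segments) such that, at each point of the curve, the surface angle to either side of the curve is at most $\pi$. It is simple if it does not intersect itself; as a degenerate case, a simple arc traversed once in each direction also counts as a simple closed curve (at its two ends, the angle to one side is $0$ and to the other side is the total surface angle at that point). Then, if $T$ is isosceles, there is no simple closed quasigeodesic on the surface of $T$ that passes through exactly one vertex of $T$. -/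

import Mathlib

open Real Set Filter Topology
open scoped ENNReal

noncomputable section

/-- A tetrahedron in `ℝ³`, given by its four vertices; every face is a non-degenerate triangle.
Flat tetrahedra (four coplanar vertices, i.e. doubly covered quadrilaterals) are allowed. -/
structure Tetrahedron where
  /-- the four vertices -/
  vertex : Fin 4 → EuclideanSpace ℝ (Fin 3)
  /-- the face opposite to vertex `i` is a genuine triangle -/
  face_nondegenerate : ∀ i : Fin 4,
    AffineIndependent ℝ (fun j : {j : Fin 4 // j ≠ i} => vertex j)

/-- The surface of a tetrahedron, in barycentric coordinates with respect to the four vertices: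
the four closed triangles `{x i = 0}` glued along the six edges. (For a non-flat tetrahedron `T`,
`T.realize` maps it bijectively onto the boundary of `T` in `ℝ³`; for a flat one it keeps
the two sheets of the double cover apart.) -/
def tetSurface : Set (Fin 4 → ℝ) :=
  {x | x ∈ stdSimplex ℝ (Fin 4) ∧ ∃ i, x i = 0}

/-- The point of the surface that is the `i`-th vertex. -/
def surfaceVertex (i : Fin 4) : Fin 4 → ℝ := Pi.single i 1

namespace Tetrahedron

/-- The point of `ℝ³` with barycentric coordinates `x` (if `x` has sum `1`); the vector of `ℝ³`
that corresponds to a displacement `x` of barycentric coordinates (if `x` has sum `0`).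
On each face this is an affine isomorphism onto a triangle of `ℝ³`, and the flat
metric of the face is the metric of that triangle. -/
def realize (T : Tetrahedron) (x : Fin 4 → ℝ) : EuclideanSpace ℝ (Fin 3) :=
  ∑ i, x i • T.vertex i

/-- The curvature of `T` at the vertex `i`: `2π` minus the sum of the three face angles at `i`. -/
def curvature (T : Tetrahedron) (i : Fin 4) : ℝ :=
  2 * π - ∑ p : Fin 4 × Fin 4 with p.1 < p.2 ∧ p.1 ≠ i ∧ p.2 ≠ i,
    EuclideanGeometry.angle (T.vertex p.1) (T.vertex i) (T.vertex p.2)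

/-- An isosceles tetrahedron: all four vertices have curvature `π`. -/
def IsIsosceles (T : Tetrahedron) : Prop := ∀ i, T.curvature i = π

/-- The space of directions at the point `x` of the surface: the unit vectors along which a
short straight segment starting at `x` stays on the surface. For every `x` this is a
closed curve, whose length is the total surface angle at `x`. -/
def directions (T : Tetrahedron) (x : Fin 4 → ℝ) : Set (Fin 4 → ℝ) :=
  {u | ‖T.realize u‖ = 1 ∧ ∀ᶠ h : ℝ in 𝓝[>] 0, x + h • u ∈ tetSurface}

/-- `σ`, restricted to `[0, 1]`, is a simple arc in the space of directions at `x`, from `u` to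
`w` (a simple closed curve if `u = w`). If `u ≠ w` there are two such arcs up to
reparametrization: they sweep out the two sectors into which the directions `u`, `w` divide
the surface near `x`. If `u = w`, one sector has angle `0`, and such an arc
sweeps out the other one, which is all of the surface near `x`. -/
structure IsSectorArc (T : Tetrahedron) (x u w : Fin 4 → ℝ) (σ : ℝ → Fin 4 → ℝ) : Prop where
  continuousOn : ContinuousOn σ (Icc 0 1)
  mapsTo : MapsTo σ (Icc 0 1) (T.directions x)
  source : σ 0 = u
  target : σ 1 = w
  injOn_Ico : InjOn σ (Ico 0 1)
  injOn_Ioc : InjOn σ (Ioc 0 1)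

/-- The surface angle swept out by an arc `σ` of directions (the length of the arc): the
supremum over all subdivisions of `[0, 1]` of the sum of the angles between
consecutive directions. -/
def sweptAngle (T : Tetrahedron) (σ : ℝ → Fin 4 → ℝ) : ℝ≥0∞ :=
  ⨆ (n : ℕ) (t : ℕ → ℝ) (_ : Monotone t ∧ ∀ k, t k ∈ Icc (0 : ℝ) 1),
    ∑ k ∈ Finset.range n, ENNReal.ofReal
      (InnerProductGeometry.angle (T.realize (σ (t k))) (T.realize (σ (t (k + 1)))))

/-- The surface angle on either side of a path that reaches `x` from the direction `u` and leaves
`x` in the direction `w` is at most `π`. -/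
def SideAnglesLePi (T : Tetrahedron) (x u w : Fin 4 → ℝ) : Prop :=
  ∀ σ : ℝ → Fin 4 → ℝ, T.IsSectorArc x u w σ → T.sweptAngle σ ≤ ENNReal.ofReal π

/-- `γ` is a closed quasigeodesic of length `L` on the surface of `T`, parametrized by arc length
and extended periodically: a closed curve on the surface that is polygonal (on each
side of each of its points it is, for a short while, a straight segment), and that has at
most `π` surface angle to either side at each point. -/
structure IsClosedQuasigeodesic (T : Tetrahedron) (L : ℝ) (γ : ℝ → Fin 4 → ℝ) : Prop where
  length_pos : 0 < L
  periodic : Function.Periodic γ L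
  mem_surface : ∀ s, γ s ∈ tetSurface
  quasi : ∀ s, ∃ u ∈ T.directions (γ s), ∃ w ∈ T.directions (γ s),
    (∀ᶠ h : ℝ in 𝓝[>] 0, γ (s - h) = γ s + h • u) ∧
    (∀ᶠ h : ℝ in 𝓝[>] 0, γ (s + h) = γ s + h • w) ∧
    T.SideAnglesLePi (γ s) u w

end Tetrahedron

/-- The closed curve `γ` of period `L` is simple: it does not meet itself during one period, or
it is a degenerate simple closed curve, that is, a simple arc traversed once in
each direction. -/
def IsSimpleClosed (L : ℝ) (γ : ℝ → Fin 4 → ℝ) : Prop :=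
  InjOn γ (Ico 0 L) ∨
    ∃ s₀, (∀ s, γ (s₀ + s) = γ (s₀ - s)) ∧ InjOn γ (Icc s₀ (s₀ + L / 2))

/-- The curve `γ` is a simple closed quasigeodesic of length `L` on the surface of `T` that
passes through exactly `k` of the vertices. -/
def Tetrahedron.IsSimpleClosedQuasigeodesicThrough (T : Tetrahedron) (k : ℕ) (L : ℝ)
    (γ : ℝ → Fin 4 → ℝ) : Prop :=
  T.IsClosedQuasigeodesic L γ ∧ IsSimpleClosed L γ ∧
    {i : Fin 4 | surfaceVertex i ∈ range γ}.ncard = k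

end

/-! An isosceles tetrahedron has equal opposite edges, so its surface is a flat pillowcase: a
half-turn about the midpoint of any edge exchanges the two faces there. Away from the vertices the
total angle is `2π`, so a quasigeodesic has exactly `π` on each side and goes straight
(`IsFrame.straight`). It crosses an edge as the half-turn prescribes (`straight_of_edge`).

In barycentric coordinates this reads: each sum `p a + p b` moves at constant speed along the curve
and is reflected exactly at the values `0` and `1` (`reflect_of_sideAnglesLePi`). At a vertex every
such sum is `0` or `1`, so on a stretch that leaves a vertex and meets no other up to time `b`, it
is a triangle wave, up to the flip `x ↦ 1 - x` (`eq_triangleWave`). If the curve is back at the same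
vertex at time `b`, the phase has advanced by an even integer, hence by an integer at time `b / 2`,
and the sum is again `0` or `1` (`midpoint_mem_of_reflected`).

This holds for all pairs at once, so the point at time `b / 2` is a vertex
(`eq_surfaceVertex_of_pair_sums`). Taking `b` to be the first return time makes it a different
vertex. Thus a closed quasigeodesic through one vertex passes through a second. -/

/-! ### Opposite edges and half-turns of an isosceles tetrahedron. -/

lemma two_mul_inner_sum_le_of_angle_sum_eq_pi {V : Type*} [NormedAddCommGroup V]
    [InnerProductSpace ℝ V] (a b c : V)
    (h : InnerProductGeometry.angle a b + InnerProductGeometry.angle a c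
      + InnerProductGeometry.angle b c = π) :
    2 * (inner ℝ a b + inner ℝ a c + inner ℝ b c) ≤ ‖a‖ ^ 2 + ‖b‖ ^ 2 + ‖c‖ ^ 2 := by
  have h1 := InnerProductGeometry.cos_angle_mul_norm_mul_norm a b
  have h2 := InnerProductGeometry.cos_angle_mul_norm_mul_norm a c
  have h3 := InnerProductGeometry.cos_angle_mul_norm_mul_norm b c
  set α := InnerProductGeometry.angle a b
  set β := InnerProductGeometry.angle a c
  have h4 : InnerProductGeometry.angle b c = π - (α + β) := by linarith
  rw [h4, cos_pi_sub, cos_add] at h3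
  rw [← h1, ← h2, ← h3]
  -- The difference of the two sides is exactly the sum of these two squares.
  nlinarith [sq_nonneg (‖a‖ - ‖b‖ * cos α - ‖c‖ * cos β),
    sq_nonneg (‖b‖ * sin α - ‖c‖ * sin β), sin_sq_add_cos_sq α, sin_sq_add_cos_sq β]

lemma dist_sq_sum_le_of_angle_sum_eq_pi {V : Type*} [NormedAddCommGroup V]
    [InnerProductSpace ℝ V] (o a b c : V)
    (h : EuclideanGeometry.angle a o b + EuclideanGeometry.angle a o c
      + EuclideanGeometry.angle b o c = π) :
    dist o a ^ 2 + dist o b ^ 2 + dist o c ^ 2 ≤ dist a b ^ 2 + dist a c ^ 2 + dist b c ^ 2 := by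
  have key := two_mul_inner_sum_le_of_angle_sum_eq_pi (a - o) (b - o) (c - o) h
  have e : ∀ x y : V, dist x y ^ 2
      = ‖x - o‖ ^ 2 - 2 * inner ℝ (x - o) (y - o) + ‖y - o‖ ^ 2 := fun x y => by
    rw [dist_eq_norm, ← norm_sub_sq_real, sub_sub_sub_cancel_right]
  have e' : ∀ x : V, dist o x = ‖x - o‖ := fun x => by rw [dist_comm, dist_eq_norm]
  rw [e a b, e a c, e b c, e' a, e' b, e' c]
  linarith

namespace Tetrahedron

variable (T : Tetrahedron)

/-- Opposite edges of an isosceles tetrahedron are equal. -/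
lemma IsIsosceles.opposite_edges {T : Tetrahedron} (hT : T.IsIsosceles) :
    dist (T.vertex 0) (T.vertex 1) ^ 2 = dist (T.vertex 2) (T.vertex 3) ^ 2 ∧
    dist (T.vertex 0) (T.vertex 2) ^ 2 = dist (T.vertex 1) (T.vertex 3) ^ 2 ∧
    dist (T.vertex 0) (T.vertex 3) ^ 2 = dist (T.vertex 1) (T.vertex 2) ^ 2 := by
  have h : ∀ i, ∑ p : Fin 4 × Fin 4 with p.1 < p.2 ∧ p.1 ≠ i ∧ p.2 ≠ i,
      EuclideanGeometry.angle (T.vertex p.1) (T.vertex i) (T.vertex p.2) = π := fun i => by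
    have := hT i
    unfold curvature at this
    linarith
  simp only [Finset.sum_filter, Fintype.sum_prod_type, Fin.sum_univ_four] at h
  have h0 := dist_sq_sum_le_of_angle_sum_eq_pi (T.vertex 0) (T.vertex 1) (T.vertex 2) (T.vertex 3)
    (by simpa using h 0)
  have h1 := dist_sq_sum_le_of_angle_sum_eq_pi (T.vertex 1) (T.vertex 0) (T.vertex 2) (T.vertex 3)
    (by simpa using h 1)
  have h2 := dist_sq_sum_le_of_angle_sum_eq_pi (T.vertex 2) (T.vertex 0) (T.vertex 1) (T.vertex 3)
    (by simpa using h 2)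
  have h3 := dist_sq_sum_le_of_angle_sum_eq_pi (T.vertex 3) (T.vertex 0) (T.vertex 1) (T.vertex 2)
    (by simpa using h 3)
  simp only [dist_comm (T.vertex 1) (T.vertex 0), dist_comm (T.vertex 2) (T.vertex 0),
    dist_comm (T.vertex 3) (T.vertex 0), dist_comm (T.vertex 2) (T.vertex 1),
    dist_comm (T.vertex 3) (T.vertex 1), dist_comm (T.vertex 3) (T.vertex 2)] at h0 h1 h2 h3
  -- Adding the inequalities at the two ends of an edge cancels the four edges adjacent to it and
  -- bounds the edge by its opposite. The other two vertices give the reverse bound.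
  refine ⟨?_, ?_, ?_⟩ <;> linarith

lemma realize_add (u w : Fin 4 → ℝ) : T.realize (u + w) = T.realize u + T.realize w := by
  simp [realize, add_smul, Finset.sum_add_distrib]

lemma realize_smul (c : ℝ) (u : Fin 4 → ℝ) : T.realize (c • u) = c • T.realize u := by
  simp [realize, mul_smul, Finset.smul_sum]

lemma realize_sub (u w : Fin 4 → ℝ) : T.realize (u - w) = T.realize u - T.realize w := by
  simp [realize, sub_smul, Finset.sum_sub_distrib]

lemma realize_neg (u : Fin 4 → ℝ) : T.realize (-u) = -T.realize u := by
  simp [realize]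

lemma sum_eq_of_distinct {M : Type*} [AddCommMonoid M] (f : Fin 4 → M) {i j k l : Fin 4}
    (h : [i, j, k, l].Nodup) :
    ∑ a, f a = f i + f j + f k + f l := by
  have : (Finset.univ : Finset (Fin 4)) = {i, j, k, l} := by
    revert i j k l; decide
  simp only [List.nodup_cons, List.mem_cons, List.not_mem_nil, not_or] at h
  rw [this, Finset.sum_insert (by simp; tauto), Finset.sum_insert (by simp; tauto),
    Finset.sum_insert (by simp; tauto), Finset.sum_singleton]
  abel

lemma dist_vertex_sq_of_distinct {T : Tetrahedron} (hT : T.IsIsosceles) {i j k l : Fin 4}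
    (h : [i, j, k, l].Nodup) :
    dist (T.vertex i) (T.vertex j) ^ 2 = dist (T.vertex k) (T.vertex l) ^ 2 := by
  obtain ⟨h1, h2, h3⟩ := hT.opposite_edges
  fin_cases i <;> fin_cases j <;> fin_cases k <;> fin_cases l <;> first
    | (exfalso; revert h; decide)
    | (simp only [Fin.zero_eta, Fin.mk_one, Fin.reduceFinMk, dist_comm (T.vertex 1) (T.vertex 0),
        dist_comm (T.vertex 2) (T.vertex 0), dist_comm (T.vertex 3) (T.vertex 0),
        dist_comm (T.vertex 2) (T.vertex 1), dist_comm (T.vertex 3) (T.vertex 1),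
        dist_comm (T.vertex 3) (T.vertex 2)]; linarith)

/-- The squared length of a displacement in terms of the squared edge lengths. -/
lemma norm_realize_sq (u : Fin 4 → ℝ) {i j k l : Fin 4} (h : [i, j, k, l].Nodup)
    (hu : ∑ a, u a = 0) :
    ‖T.realize u‖ ^ 2 = -(u i * u j * dist (T.vertex i) (T.vertex j) ^ 2
      + u i * u k * dist (T.vertex i) (T.vertex k) ^ 2
      + u i * u l * dist (T.vertex i) (T.vertex l) ^ 2
      + u j * u k * dist (T.vertex j) (T.vertex k) ^ 2
      + u j * u l * dist (T.vertex j) (T.vertex l) ^ 2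
      + u k * u l * dist (T.vertex k) (T.vertex l) ^ 2) := by
  rw [sum_eq_of_distinct _ h] at hu
  rw [realize, sum_eq_of_distinct _ h]
  have hi : u i = -(u j + u k + u l) := by linarith
  simp only [dist_eq_norm, ← real_inner_self_eq_norm_sq, inner_add_left, inner_add_right,
    inner_sub_left, inner_sub_right, real_inner_smul_left, real_inner_smul_right, hi,
    real_inner_comm (T.vertex i), real_inner_comm (T.vertex j) (T.vertex k),
    real_inner_comm (T.vertex j) (T.vertex l), real_inner_comm (T.vertex k) (T.vertex l)]
  ring

/-- The half-turn symmetry of an isosceles tetrahedron that swaps `i, j` and `k, l`. -/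
lemma norm_realize_comp_swap {T : Tetrahedron} (hT : T.IsIsosceles) (u w : Fin 4 → ℝ)
    {i j k l : Fin 4} (h : [i, j, k, l].Nodup) (hu : ∑ a, u a = 0)
    (hi : w i = u j) (hj : w j = u i) (hk : w k = u l) (hl : w l = u k) :
    ‖T.realize w‖ = ‖T.realize u‖ := by
  have hw : ∑ a, w a = 0 := by
    rw [sum_eq_of_distinct _ h] at hu ⊢; linarith
  have e : ‖T.realize w‖ ^ 2 = ‖T.realize u‖ ^ 2 := by
    rw [T.norm_realize_sq w h hw, T.norm_realize_sq u h hu, hi, hj, hk, hl]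
    simp only [List.nodup_cons, List.mem_cons, List.not_mem_nil, not_or] at h
    -- The swap maps the edges `ij` and `kl` to themselves, so only the other two pairs of opposite
    -- edges matter.
    have e1 := dist_vertex_sq_of_distinct hT (i := i) (j := k) (k := j) (l := l)
      (by simp; tauto)
    have e2 := dist_vertex_sq_of_distinct hT (i := i) (j := l) (k := j) (l := k)
      (by simp; tauto)
    rw [e1, e2]; ring
  exact (sq_eq_sq₀ (norm_nonneg _) (norm_nonneg _)).1 e

/-- `realize` is injective on the displacements along a face. -/
lemma eq_zero_of_realize_eq_zero (u : Fin 4 → ℝ) (j : Fin 4) (hj : u j = 0) (hu : ∑ a, u a = 0)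
    (h : T.realize u = 0) : u = 0 := by
  have key := (affineIndependent_iff_of_fintype ..).1 (T.face_nondegenerate j)
  have s : ∀ {M : Type} [AddCommMonoid M] (f : Fin 4 → M), f j = 0 →
      ∑ a : {a // a ≠ j}, f a = ∑ a, f a := fun f hf => by
    rw [← Fintype.sum_subtype_add_sum_subtype (fun a => a ≠ j) f]
    simp [Fintype.sum_eq_zero, hf]
  have hs : ∑ a : {a // a ≠ j}, u a = 0 := by rw [s u hj, hu]
  have hv : Finset.univ.weightedVSub (fun a : {a // a ≠ j} => T.vertex a)
      (fun a : {a // a ≠ j} => u a) = (0 : EuclideanSpace ℝ (Fin 3)) := by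
    rw [Finset.weightedVSub_eq_weightedVSubOfPoint_of_sum_eq_zero _ _ _ hs 0]
    simp only [Finset.weightedVSubOfPoint_apply, vsub_eq_sub, sub_zero]
    rw [s (fun a => u a • T.vertex a) (by simp [hj])]
    exact h
  funext a
  by_cases ha : a = j
  · rw [ha]; exact hj
  · exact key _ hs hv ⟨a, ha⟩

end Tetrahedron

/-! ### Unfolding the directions at a point that is not a vertex. -/

noncomputable section

/-- The circle of directions at angle `θ` that is spanned by two half-planes with the common axis `E`
and with the orthogonal directions `F` (for `sin θ ≥ 0`) and `G` (for `sin θ ≤ 0`). -/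
def bentCircle (E F G : Fin 4 → ℝ) (θ : ℝ) : Fin 4 → ℝ :=
  cos θ • E + max (sin θ) 0 • F + max (-sin θ) 0 • G

lemma continuous_bentCircle (E F G : Fin 4 → ℝ) : Continuous (bentCircle E F G) := by
  unfold bentCircle; fun_prop

lemma bentCircle_of_nonneg (E F G : Fin 4 → ℝ) {θ : ℝ} (h : 0 ≤ sin θ) :
    bentCircle E F G θ = cos θ • E + sin θ • F := by
  rw [bentCircle, max_eq_left h, max_eq_right (by linarith), zero_smul, add_zero]

lemma bentCircle_of_nonpos (E F G : Fin 4 → ℝ) {θ : ℝ} (h : sin θ ≤ 0) :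
    bentCircle E F G θ = cos θ • E + (-sin θ) • G := by
  rw [bentCircle, max_eq_right h, max_eq_left (by linarith), zero_smul, add_zero]

lemma bentCircle_neg (E F G : Fin 4 → ℝ) (θ : ℝ) :
    bentCircle E F G (-θ) = bentCircle E G F θ := by
  simp only [bentCircle, cos_neg, sin_neg, neg_neg]; abel

/-- Expresses going straight on. For `G = -F` (inside a face) the right side is the negative of the
direction at `θ`; at an edge, where a half-turn takes `E` to `-E` and swaps `F` and `G`, it is the
image under that half-turn. -/
lemma bentCircle_add_pi (E F G : Fin 4 → ℝ) (θ : ℝ) :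
    bentCircle E F G (θ + π) = bentCircle (-E) G F θ := by
  simp only [bentCircle, cos_add_pi, sin_add_pi, neg_neg, neg_smul, smul_neg]; abel

lemma bentCircle_add_int_mul (E F G : Fin 4 → ℝ) (θ : ℝ) (n : ℤ) :
    bentCircle E F G (θ + n * (2 * π)) = bentCircle E F G θ := by
  simp only [bentCircle, cos_add_int_mul_two_pi, sin_add_int_mul_two_pi]

namespace Tetrahedron

/-- The directions `E, F, G` unfold the space of directions at `p` to a circle of length `2π`. -/
structure IsFrame (T : Tetrahedron) (p E F G : Fin 4 → ℝ) : Prop where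
  norm_E : ‖T.realize E‖ = 1
  norm_F : ‖T.realize F‖ = 1
  norm_G : ‖T.realize G‖ = 1
  inner_EF : inner ℝ (T.realize E) (T.realize F) = 0
  inner_EG : inner ℝ (T.realize E) (T.realize G) = 0
  mem : ∀ θ, bentCircle E F G θ ∈ T.directions p
  surj : ∀ u ∈ T.directions p, ∃ θ, u = bentCircle E F G θ
  inj : ∀ θ φ, bentCircle E F G θ = bentCircle E F G φ → cos θ = cos φ ∧ sin θ = sin φ

variable {T : Tetrahedron} {p E F G : Fin 4 → ℝ}

/-- Reversing the orientation exchanges the two sides of a path, so a bound for one side gives the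
bound for the other. -/
lemma IsFrame.mirror (h : T.IsFrame p E F G) : T.IsFrame p E G F where
  norm_E := h.norm_E
  norm_F := h.norm_G
  norm_G := h.norm_F
  inner_EF := h.inner_EG
  inner_EG := h.inner_EF
  mem θ := bentCircle_neg E F G θ ▸ h.mem _
  surj u hu := by
    obtain ⟨θ, rfl⟩ := h.surj u hu
    exact ⟨-θ, (bentCircle_neg E G F θ).symm⟩
  inj θ φ e := by
    rw [← bentCircle_neg E F G θ, ← bentCircle_neg E F G φ] at e
    simpa using h.inj _ _ e

lemma angle_cos_add_sin {V : Type*} [NormedAddCommGroup V] [InnerProductSpace ℝ V] {x y : V}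
    (hx : ‖x‖ = 1) (hy : ‖y‖ = 1) (hxy : inner ℝ x y = 0) {θ φ : ℝ} (h : θ ≤ φ) (h' : φ ≤ θ + π) :
    InnerProductGeometry.angle (cos θ • x + sin θ • y) (cos φ • x + sin φ • y) = φ - θ := by
  have hi : ∀ a b : ℝ,
      inner ℝ (cos a • x + sin a • y) (cos b • x + sin b • y) = cos (b - a) := fun a b => by
    simp only [inner_add_left, inner_add_right, real_inner_smul_left, real_inner_smul_right, hxy,
      real_inner_self_eq_norm_sq, hx, hy, real_inner_comm x y, cos_sub]
    ring
  have hn : ∀ a : ℝ, ‖cos a • x + sin a • y‖ = 1 := fun a => by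
    have := hi a a
    rw [real_inner_self_eq_norm_sq, sub_self, cos_zero] at this
    exact (pow_eq_one_iff_of_nonneg (norm_nonneg _) two_ne_zero).1 this
  rw [InnerProductGeometry.angle, hi, hn, hn, mul_one, div_one,
    arccos_cos (by linarith) (by linarith)]

lemma IsFrame.angle_of_nonneg (h : T.IsFrame p E F G) {θ φ : ℝ} (h1 : θ ≤ φ) (h2 : φ ≤ θ + π)
    (hθ : 0 ≤ sin θ) (hφ : 0 ≤ sin φ) :
    InnerProductGeometry.angle (T.realize (bentCircle E F G θ)) (T.realize (bentCircle E F G φ))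
      = φ - θ := by
  simp only [bentCircle_of_nonneg E F G hθ, bentCircle_of_nonneg E F G hφ, realize_add,
    realize_smul]
  exact angle_cos_add_sin h.norm_E h.norm_F h.inner_EF h1 h2

lemma IsFrame.angle_of_nonpos (h : T.IsFrame p E F G) {θ φ : ℝ} (h1 : θ ≤ φ) (h2 : φ ≤ θ + π)
    (hθ : sin θ ≤ 0) (hφ : sin φ ≤ 0) :
    InnerProductGeometry.angle (T.realize (bentCircle E F G θ)) (T.realize (bentCircle E F G φ))
      = φ - θ := by
  rw [← bentCircle_neg E G F θ, ← bentCircle_neg E G F φ, InnerProductGeometry.angle_comm,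
    h.mirror.angle_of_nonneg (by linarith) (by linarith) (by simpa using hφ) (by simpa using hθ)]
  ring

lemma sin_int_mul_pi_sign (k : ℤ) :
    (∀ x ∈ Icc (k * π) ((k + 1) * π), 0 ≤ sin x) ∨ (∀ x ∈ Icc (k * π) ((k + 1) * π), sin x ≤ 0) := by
  obtain ⟨m, rfl | rfl⟩ := Int.even_or_odd' k
  · left
    intro x hx
    push_cast at hx
    rw [← sin_sub_int_mul_two_pi x m]
    exact sin_nonneg_of_nonneg_of_le_pi (by linarith [hx.1]) (by linarith [hx.2])
  · right
    intro x hx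
    push_cast at hx
    rw [← sin_sub_int_mul_two_pi x (m + 1)]
    push_cast
    exact sin_nonpos_of_nonpos_of_neg_pi_le (by linarith [hx.2]) (by linarith [hx.1])

/-- Across the bend the angle in `ℝ³` may be smaller than the surface angle. The parameter interval
is therefore cut at the multiples of `π`, where the circle meets the axis; each piece lies in one
half-plane, where both angles agree. Clamping to `[α, β]` makes the pieces outside trivial. -/
lemma IsFrame.sub_le_angle_clamp (h : T.IsFrame p E F G) (α β : ℝ) (k : ℕ) :
    max α (min ((k + 1 : ℕ) * π) β) - max α (min (k * π) β) ≤
    InnerProductGeometry.angle (T.realize (bentCircle E F G (max α (min (k * π) β))))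
      (T.realize (bentCircle E F G (max α (min ((k + 1 : ℕ) * π) β)))) := by
  have hpi := pi_pos
  have hk : ((k + 1 : ℕ) : ℝ) * π = (k + 1) * π := by push_cast; ring
  rw [hk]
  have hkk : (k : ℝ) * π ≤ (k + 1) * π := by linarith
  rcases le_or_gt ((k + 1) * π) α with h1 | h1
  · rw [max_eq_left ((min_le_left _ _).trans h1),
      max_eq_left ((min_le_left _ _).trans (hkk.trans h1)), sub_self]
    exact InnerProductGeometry.angle_nonneg _ _
  rcases le_or_gt β (k * π) with h2 | h2
  · rw [min_eq_right h2, min_eq_right (h2.trans hkk), sub_self]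
    exact InnerProductGeometry.angle_nonneg _ _
  have m1 : max α (min (k * π) β) ∈ Icc (k * π) ((k + 1) * π) :=
    ⟨le_max_of_le_right (le_min le_rfl h2.le), max_le h1.le ((min_le_left _ _).trans hkk)⟩
  have m2 : max α (min ((k + 1) * π) β) ∈ Icc (k * π) ((k + 1) * π) :=
    ⟨le_max_of_le_right (le_min hkk h2.le), max_le h1.le (min_le_left _ _)⟩
  have hle : max α (min (k * π) β) ≤ max α (min ((k + 1) * π) β) :=
    max_le_max le_rfl (min_le_min hkk le_rfl)
  have hle' : max α (min ((k + 1) * π) β) ≤ max α (min (k * π) β) + π := by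
    linarith [m1.1, m2.2]
  rcases sin_int_mul_pi_sign k with hs | hs
  · exact (h.angle_of_nonneg hle hle' (hs _ m1) (hs _ m2)).ge
  · exact (h.angle_of_nonpos hle hle' (hs _ m1) (hs _ m2)).ge

lemma IsFrame.isSectorArc (h : T.IsFrame p E F G) (θ : ℝ) {c : ℝ} (hc : 0 < c) (hc' : c ≤ 2 * π) :
    T.IsSectorArc p (bentCircle E F G θ) (bentCircle E F G (θ + c))
      (fun t => bentCircle E F G (θ + t * c)) := by
  -- The strict bound covers both half-open intervals and still allows the full loop `c = 2 * π`.
  have inj : ∀ s t : ℝ, |s - t| < 1 → bentCircle E F G (θ + s * c) = bentCircle E F G (θ + t * c) →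
      s = t := fun s t hst e => by
    obtain ⟨h1, h2⟩ := h.inj _ _ e
    obtain ⟨n, hn⟩ := Angle.angle_eq_iff_two_pi_dvd_sub.1 (Angle.cos_sin_inj h1 h2)
    have h3 : (s - t) * c = 2 * π * n := by linarith
    have h4 : |(n : ℝ)| < 1 := by
      have : |(s - t) * c| < 2 * π := by
        rw [abs_mul, abs_of_pos hc]
        exact (mul_lt_of_lt_one_left hc hst).trans_le hc'
      rw [h3, abs_mul, abs_of_pos two_pi_pos] at this
      exact (mul_lt_iff_lt_one_right two_pi_pos).1 this
    have h5 : n = 0 := Int.abs_lt_one_iff.1 (by exact_mod_cast h4)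
    rw [h5, Int.cast_zero, mul_zero, mul_eq_zero, sub_eq_zero] at h3
    exact h3.resolve_right hc.ne'
  refine ⟨?_, fun t _ => h.mem _, by simp, by simp, ?_, ?_⟩
  · exact ((continuous_bentCircle E F G).comp (by fun_prop)).continuousOn
  · exact fun s hs t ht e => inj s t (abs_lt.2 ⟨by linarith [hs.1, ht.2], by linarith [hs.2, ht.1]⟩) e
  · exact fun s hs t ht e => inj s t (abs_lt.2 ⟨by linarith [hs.1, ht.2], by linarith [hs.2, ht.1]⟩) e

lemma IsFrame.le_pi_of_sideAnglesLePi (h : T.IsFrame p E F G) {θ c : ℝ} (hθ : 0 ≤ θ)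
    (hθ' : θ ≤ 2 * π) (hc : 0 < c) (hc' : c ≤ 2 * π)
    (hs : T.SideAnglesLePi p (bentCircle E F G θ) (bentCircle E F G (θ + c))) : c ≤ π := by
  have key := hs _ (h.isSectorArc θ hc hc')
  -- Four pieces suffice, since `0 ≤ θ` and `θ + c ≤ 4 * π`.
  let a : ℕ → ℝ := fun k => max θ (min (k * π) (θ + c))
  have ha0 : a 0 = θ := by simp [a, hθ]
  have ha4 : a 4 = θ + c := by
    simp only [a]
    rw [min_eq_right (by push_cast; linarith), max_eq_right (by linarith)]
  have hmono : Monotone a := fun i j hij => by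
    refine max_le_max le_rfl (min_le_min ?_ le_rfl)
    exact mul_le_mul_of_nonneg_right (by exact_mod_cast hij) pi_pos.le
  have hle : ∀ k, a k ≤ θ + c := fun k => max_le (by linarith) (min_le_right _ _)
  have hσ : ∀ k, θ + (a k - θ) / c * c = a k := fun k => by field_simp; ring
  have h1 : ENNReal.ofReal c ≤ T.sweptAngle (fun t => bentCircle E F G (θ + t * c)) := by
    refine le_trans ?_ (le_iSup_of_le 4 (le_iSup_of_le (fun k => (a k - θ) / c)
      (le_iSup_of_le ⟨?_, ?_⟩ le_rfl)))
    · simp only [hσ]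
      rw [← ENNReal.ofReal_sum_of_nonneg fun _ _ => InnerProductGeometry.angle_nonneg _ _]
      refine ENNReal.ofReal_le_ofReal ?_
      have : c = ∑ k ∈ Finset.range 4, (a (k + 1) - a k) := by
        rw [Finset.sum_range_sub, ha0, ha4]; ring
      rw [this]
      exact Finset.sum_le_sum fun k _ => h.sub_le_angle_clamp θ (θ + c) k
    · exact fun i j hij => by
        have := hmono hij
        simp only
        gcongr
    · exact fun k => ⟨div_nonneg (by linarith [le_max_left θ (min (k * π) (θ + c))]) hc.le,
        div_le_one_of_le₀ (by linarith [hle k]) hc.le⟩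
  exact (ENNReal.ofReal_le_ofReal_iff pi_pos.le).1 (h1.trans key)

lemma exists_add_int_mul_mem_Ico (θ : ℝ) : ∃ n : ℤ, θ + n * (2 * π) ∈ Ico 0 (2 * π) := by
  refine ⟨-⌊θ / (2 * π)⌋, ?_⟩
  have h1 := Int.floor_le (θ / (2 * π))
  have h2 := Int.lt_floor_add_one (θ / (2 * π))
  rw [le_div_iff₀ two_pi_pos] at h1
  rw [div_lt_iff₀ two_pi_pos] at h2
  push_cast
  exact ⟨by linarith, by linarith⟩

/-- If the angles on both sides are at most `π`, the path goes straight on. -/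
lemma IsFrame.straight (h : T.IsFrame p E F G) {u w : Fin 4 → ℝ} (hu : u ∈ T.directions p)
    (hw : w ∈ T.directions p) (hs : T.SideAnglesLePi p u w) :
    ∃ θ, u = bentCircle E F G θ ∧ w = bentCircle (-E) G F θ := by
  obtain ⟨θ₀, rfl⟩ := h.surj u hu
  obtain ⟨φ₀, rfl⟩ := h.surj w hw
  obtain ⟨n, hn⟩ := exists_add_int_mul_mem_Ico θ₀
  rw [← bentCircle_add_int_mul E F G θ₀ n] at hs ⊢
  generalize θ₀ + n * (2 * π) = θ at hn hs
  obtain ⟨m, hm⟩ := exists_add_int_mul_mem_Ico (θ - φ₀)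
  -- The angle from `u` to `w` in the positive sense, normalized to `(0, 2π]`, so that `u = w` gives
  -- the full circle.
  obtain ⟨c, hc⟩ : ∃ c, c = 2 * π - (θ - φ₀ + m * (2 * π)) := ⟨_, rfl⟩
  have e : bentCircle E F G φ₀ = bentCircle E F G (θ + c) := by
    rw [← bentCircle_add_int_mul E F G φ₀ (1 - m)]
    congr 1; push_cast; linarith
  rw [e] at hs ⊢
  have hc0 : 0 < c := by linarith [hm.2]
  have h1 := h.le_pi_of_sideAnglesLePi hn.1 hn.2.le hc0 (by linarith [hm.1]) hs
  have e1 : bentCircle E F G θ = bentCircle E G F (2 * π - θ) := by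
    rw [← bentCircle_neg E F G, ← bentCircle_add_int_mul E F G θ (-1)]
    congr 1; push_cast; ring
  have e2 : bentCircle E F G (θ + c) = bentCircle E G F (2 * π - θ + (2 * π - c)) := by
    rw [← bentCircle_neg E F G, ← bentCircle_add_int_mul E F G (θ + c) (-2)]
    congr 1; push_cast; ring
  -- The other side has angle `2 * π - c`, which is positive because `c ≤ π` is already known.
  have h2 := h.mirror.le_pi_of_sideAnglesLePi (θ := 2 * π - θ) (c := 2 * π - c)
    (by linarith [hn.2]) (by linarith [hn.1]) (by linarith [pi_pos]) (by linarith)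
    (by rwa [← e1, ← e2])
  have h3 : c = π := by linarith
  exact ⟨θ, rfl, by rw [h3, bentCircle_add_pi]⟩

end Tetrahedron
end

/-! ### Reflected motion on the unit interval. -/

noncomputable section

/-- The triangle wave of period `2` with value `0` at even and `1` at odd integers. -/
def triangleWave (x : ℝ) : ℝ := arccos (cos (π * x)) / π

lemma continuous_triangleWave : Continuous triangleWave := by
  unfold triangleWave; fun_prop

lemma triangleWave_of_mem_Icc_even (k : ℤ) {x : ℝ} (h : x ∈ Icc (2 * k : ℝ) (2 * k + 1)) :
    triangleWave x = x - 2 * k := by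
  have e : cos (π * x) = cos (π * (x - 2 * k)) := by
    rw [← cos_sub_int_mul_two_pi (π * x) k]; congr 1; ring
  rw [triangleWave, e, arccos_cos (mul_nonneg pi_pos.le (by linarith [h.1]))
    (mul_le_of_le_one_right pi_pos.le (by linarith [h.2]))]
  field_simp

lemma triangleWave_of_mem_Icc_odd (k : ℤ) {x : ℝ} (h : x ∈ Icc (2 * k - 1 : ℝ) (2 * k)) :
    triangleWave x = 2 * k - x := by
  have e : cos (π * x) = cos (π * (2 * k - x)) := by
    rw [← cos_neg (π * (2 * k - x)), ← cos_sub_int_mul_two_pi (π * x) k]; congr 1; ring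
  rw [triangleWave, e, arccos_cos (mul_nonneg pi_pos.le (by linarith [h.2]))
    (mul_le_of_le_one_right pi_pos.le (by linarith [h.1]))]
  field_simp

/-- The triangle wave is piecewise linear: it has slope `±1`, and changes direction exactly where it
has value `0` or `1`. -/
lemma triangleWave_local (x : ℝ) : ∃ l r : ℝ,
    (∀ᶠ h : ℝ in 𝓝[≥] 0, triangleWave (x - h) = triangleWave x + h * l) ∧
    (∀ᶠ h : ℝ in 𝓝[≥] 0, triangleWave (x + h) = triangleWave x + h * r) ∧
    (triangleWave x ∈ ({0, 1} : Set ℝ) ∧ r = l ∨ triangleWave x ∉ ({0, 1} : Set ℝ) ∧ r = -l) := by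
  have ev : ∀ d : ℝ, 0 < d → ∀ᶠ h : ℝ in 𝓝[≥] 0, h ∈ Ico 0 d := fun d hd =>
    Ico_mem_nhdsGE hd
  obtain ⟨m, hm⟩ : ∃ m : ℤ, m = ⌊x⌋ := ⟨_, rfl⟩
  have h1 : (m : ℝ) ≤ x := hm ▸ Int.floor_le x
  have h2 : x < m + 1 := hm ▸ Int.lt_floor_add_one x
  obtain ⟨k, rfl | rfl⟩ := Int.even_or_odd' m
  · push_cast at h1 h2
    have e0 := triangleWave_of_mem_Icc_even k ⟨h1, h2.le⟩
    rcases h1.eq_or_lt with h | h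
    · refine ⟨1, 1, (ev 1 one_pos).mono fun t ht => ?_, (ev 1 one_pos).mono fun t ht => ?_,
        Or.inl ⟨by simp [e0, h], rfl⟩⟩
      · rw [e0, triangleWave_of_mem_Icc_odd k ⟨by linarith [ht.2], by linarith [ht.1]⟩]; linarith
      · rw [e0, triangleWave_of_mem_Icc_even k ⟨by linarith [ht.1], by linarith [ht.2]⟩]; ring
    · refine ⟨-1, 1, (ev (x - 2 * k) (by linarith)).mono fun t ht => ?_,
        (ev (2 * k + 1 - x) (by linarith)).mono fun t ht => ?_, Or.inr ⟨?_, by ring⟩⟩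
      · rw [e0, triangleWave_of_mem_Icc_even k ⟨by linarith [ht.2], by linarith [ht.1]⟩]; ring
      · rw [e0, triangleWave_of_mem_Icc_even k ⟨by linarith [ht.1], by linarith [ht.2]⟩]; ring
      · rw [e0, mem_insert_iff, mem_singleton_iff]; rintro (h' | h') <;> linarith
  · push_cast at h1 h2
    have e0 := triangleWave_of_mem_Icc_odd (k + 1) (x := x)
      ⟨by push_cast; linarith, by push_cast; linarith⟩
    push_cast at e0
    rcases h1.eq_or_lt with h | h
    · refine ⟨-1, -1, (ev 1 one_pos).mono fun t ht => ?_, (ev 1 one_pos).mono fun t ht => ?_,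
        Or.inl ⟨Or.inr (by rw [e0, mem_singleton_iff]; linarith), rfl⟩⟩
      · rw [e0, triangleWave_of_mem_Icc_even k ⟨by linarith [ht.2], by linarith [ht.1]⟩]; linarith
      · rw [e0, triangleWave_of_mem_Icc_odd (k + 1)
          ⟨by push_cast; linarith [ht.1], by push_cast; linarith [ht.2]⟩]
        push_cast; ring
    · refine ⟨1, -1, (ev (x - (2 * k + 1)) (by linarith)).mono fun t ht => ?_,
        (ev (2 * k + 2 - x) (by linarith)).mono fun t ht => ?_, Or.inr ⟨?_, by ring⟩⟩
      · rw [e0, triangleWave_of_mem_Icc_odd (k + 1)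
          ⟨by push_cast; linarith [ht.2], by push_cast; linarith [ht.1]⟩]
        push_cast; ring
      · rw [e0, triangleWave_of_mem_Icc_odd (k + 1)
          ⟨by push_cast; linarith [ht.1], by push_cast; linarith [ht.2]⟩]
        push_cast; ring
      · rw [e0, mem_insert_iff, mem_singleton_iff]; rintro (h' | h') <;> linarith

/-- A function with values in `[0, 1]` that is piecewise linear and is reflected exactly where it has
value `0` or `1` is a triangle wave. -/
lemma eq_triangleWave {X : ℝ → ℝ} {b v : ℝ} (hX : Continuous X)
    (h01 : ∀ t, X t ∈ Icc (0 : ℝ) 1) (h0 : X 0 = 0)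
    (hv : ∀ᶠ h : ℝ in 𝓝[>] 0, X h = h * v)
    (hloc : ∀ t ∈ Ioo 0 b, ∃ l r : ℝ,
      (∀ᶠ h : ℝ in 𝓝[>] 0, X (t - h) = X t + h * l) ∧
      (∀ᶠ h : ℝ in 𝓝[>] 0, X (t + h) = X t + h * r) ∧
      (X t ∈ ({0, 1} : Set ℝ) ∧ r = l ∨ X t ∉ ({0, 1} : Set ℝ) ∧ r = -l)) :
    ∀ t ∈ Icc 0 b, X t = triangleWave (v * t) := by
  have hpos : ∀ᶠ h : ℝ in 𝓝[>] 0, 0 < h := eventually_mem_nhdsWithin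
  have hlt : ∀ d : ℝ, 0 < d → ∀ᶠ h : ℝ in 𝓝[>] 0, h < d := fun d hd =>
    (Ioo_mem_nhdsGT hd : Ioo 0 d ∈ 𝓝[>] (0 : ℝ)) |> fun h => mem_of_superset h fun _ hx => hx.2
  have hv0 : 0 ≤ v := by
    obtain ⟨h, hh, hp⟩ := (hv.and hpos).exists
    have := (h01 h).1
    rw [hh] at this
    exact nonneg_of_mul_nonneg_right this hp
  -- The speed `v` may be `0`, so the target filter has to include the point `0`.
  have hscale : Tendsto (fun h : ℝ => v * h) (𝓝[>] 0) (𝓝[≥] 0) := by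
    refine tendsto_nhdsWithin_iff.2 ⟨?_, hpos.mono fun h hh => mul_nonneg hv0 hh.le⟩
    have : Tendsto (fun h : ℝ => v * h) (𝓝 0) (𝓝 (v * 0)) := (continuous_const_mul v).tendsto 0
    rw [mul_zero] at this
    exact this.mono_left nhdsWithin_le_nhds
  -- Agreement on all of `[0, t]`, rescaled to a fixed range of `q` so that `S` is visibly an
  -- intersection of closed sets.
  let S : Set ℝ := {t | ∀ q ∈ Icc (0 : ℝ) 1, X (q * t) = triangleWave (v * (q * t))}
  have hS : ∀ {t}, 0 ≤ t → (t ∈ S ↔ ∀ τ ∈ Icc 0 t, X τ = triangleWave (v * τ)) := fun {t} ht => by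
    constructor
    · intro h τ hτ
      rcases ht.eq_or_lt with rfl | ht
      · have : τ = 0 := le_antisymm hτ.2 hτ.1
        simpa [this] using h 0 (by simp)
      · have := h (τ / t) ⟨div_nonneg hτ.1 ht.le, div_le_one_of_le₀ hτ.2 ht.le⟩
        rwa [div_mul_cancel₀ _ ht.ne'] at this
    · exact fun h q hq => h _ ⟨mul_nonneg hq.1 ht, mul_le_of_le_one_left ht hq.2⟩
  have hw0 : triangleWave 0 = 0 := by
    simpa using triangleWave_of_mem_Icc_even 0 (x := 0) (by simp)
  have hS0 : (0 : ℝ) ∈ S := fun q _ => by simp [h0, hw0]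
  have hSc : IsClosed S := by
    have : S = ⋂ q ∈ Icc (0 : ℝ) 1, {t | X (q * t) = triangleWave (v * (q * t))} := by
      ext t; simp [S]
    rw [this]
    have := continuous_triangleWave
    exact isClosed_biInter fun q _ => isClosed_eq (by fun_prop) (by fun_prop)
  have hstep : ∀ t ∈ Ico 0 b, t ∈ S →
      ∀ᶠ h : ℝ in 𝓝[>] 0, X (t + h) = triangleWave (v * (t + h)) := by
    intro t ht htS
    have htS' := (hS ht.1).1 htS
    have hXt := htS' t ⟨ht.1, le_rfl⟩
    obtain ⟨l', r', hl', hr', hc'⟩ := triangleWave_local (v * t)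
    have hl'' := hscale.eventually hl'
    have hr'' := hscale.eventually hr'
    rcases ht.1.eq_or_lt with rfl | ht0
    · obtain ⟨-, r', -, hr', -⟩ := triangleWave_local (v * 0)
      have hev : ∀ᶠ h : ℝ in 𝓝[≥] 0, triangleWave h = h :=
        mem_of_superset (Icc_mem_nhdsGE one_pos) fun h hh => by
          simpa using triangleWave_of_mem_Icc_even 0 (x := h) (by simpa using hh)
      filter_upwards [hv, hscale.eventually hev] with h h1 h2
      rw [zero_add, h1, h2, mul_comm]
    · obtain ⟨l, r, hl, hr, hc⟩ := hloc t ⟨ht0, ht.2⟩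
      -- Agreement before `t` forces equal slopes on the left. Whether the slope then turns depends
      -- only on the common value at `t`, so the slopes on the right agree too.
      have hll : l = v * l' := by
        obtain ⟨h, ⟨⟨h1, h2⟩, h3⟩, h4⟩ := (((hl.and hl'').and hpos).and (hlt t ht0)).exists
        rw [htS' (t - h) ⟨by linarith, by linarith⟩, mul_sub, h2, hXt] at h1
        have : h * l = h * (v * l') := by linarith
        exact mul_left_cancel₀ h3.ne' this
      have hrr : r = v * r' := by
        rw [hXt] at hc
        rcases hc with ⟨h1, h2⟩ | ⟨h1, h2⟩ <;> rcases hc' with ⟨h3, h4⟩ | ⟨h3, h4⟩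
        · rw [h2, h4, hll]
        · exact absurd h1 h3
        · exact absurd h3 h1
        · rw [h2, h4, hll, mul_neg]
      filter_upwards [hr, hr''] with h h1 h2
      rw [h1, mul_add, h2, hXt, hrr]; ring
  have hsub : Icc 0 b ⊆ S := by
    refine IsClosed.Icc_subset_of_forall_mem_nhdsWithin (hSc.inter isClosed_Icc) hS0 ?_
    rintro t ⟨htS, ht⟩
    obtain ⟨d, hd, hd'⟩ := (mem_nhdsGT_iff_exists_Ioo_subset).1 (hstep t ht htS)
    have hd : 0 < d := hd
    refine mem_of_superset (Ioo_mem_nhdsGT (show t < t + d by linarith)) fun s hs => ?_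
    refine (hS (ht.1.trans hs.1.le)).2 fun τ hτ => ?_
    rcases le_or_gt τ t with h | h
    · exact (hS ht.1).1 htS τ ⟨hτ.1, h⟩
    · have := hd' (show τ - t ∈ Ioo 0 d from ⟨by linarith, by linarith [hτ.2, hs.2]⟩)
      simpa using this
  exact fun t ht => (hS ht.1).1 (hsub ht) t ⟨ht.1, le_rfl⟩

/-- The zeros of the wave are the even integers, and at every integer its value is `0` or `1`. -/
lemma triangleWave_half_mem {x : ℝ} (h : triangleWave x = 0) :
    triangleWave (x / 2) ∈ ({0, 1} : Set ℝ) := by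
  have h1 : cos (π * x) = 1 := by
    have : arccos (cos (π * x)) = 0 := by
      simpa [triangleWave, pi_ne_zero] using h
    exact le_antisymm (cos_le_one _) (arccos_eq_zero.1 this)
  obtain ⟨n, hn⟩ := (cos_eq_one_iff _).1 h1
  have hx : x / 2 = n := by
    have : π * (2 * n) = π * x := by linarith
    linarith [mul_left_cancel₀ pi_ne_zero this]
  rw [hx]
  obtain ⟨k, rfl | rfl⟩ := Int.even_or_odd' n
  · left
    rw [triangleWave_of_mem_Icc_even k (by push_cast; simp)]; push_cast; ring
  · right
    rw [triangleWave_of_mem_Icc_even k (by push_cast; simp)]; push_cast; simp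

/-- The midpoint of a reflected motion on `[0, 1]` that returns to the end it started from. -/
lemma midpoint_mem_of_reflected {X : ℝ → ℝ} {b v : ℝ} (hb : 0 < b) (hX : Continuous X)
    (h01 : ∀ t, X t ∈ Icc (0 : ℝ) 1) (h0 : X 0 ∈ ({0, 1} : Set ℝ)) (hb0 : X b = X 0)
    (hv : ∀ᶠ h : ℝ in 𝓝[>] 0, X h = X 0 + h * v)
    (hloc : ∀ t ∈ Ioo 0 b, ∃ l r : ℝ,
      (∀ᶠ h : ℝ in 𝓝[>] 0, X (t - h) = X t + h * l) ∧
      (∀ᶠ h : ℝ in 𝓝[>] 0, X (t + h) = X t + h * r) ∧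
      (X t ∈ ({0, 1} : Set ℝ) ∧ r = l ∨ X t ∉ ({0, 1} : Set ℝ) ∧ r = -l)) :
    X (b / 2) ∈ ({0, 1} : Set ℝ) := by
  rcases h0 with h0 | h0
  · have key := eq_triangleWave hX h01 h0 (hv.mono fun h hh => by rw [hh, h0, zero_add]) hloc
    have h1 := key b ⟨hb.le, le_rfl⟩
    rw [key (b / 2) ⟨by linarith, by linarith⟩, ← mul_div_assoc]
    exact triangleWave_half_mem (by rw [← h1, hb0, h0])
  · rw [mem_singleton_iff] at h0
    -- A start at `1` becomes a start at `0` on passing to `1 - X`, which negates all slopes and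
    -- keeps the turning points.
    have flip : ∀ x : ℝ, 1 - x ∈ ({0, 1} : Set ℝ) ↔ x ∈ ({0, 1} : Set ℝ) := fun x => by
      simp only [mem_insert_iff, mem_singleton_iff]
      constructor <;> rintro (h | h)
      exacts [Or.inr (by linarith), Or.inl (by linarith), Or.inr (by linarith),
        Or.inl (by linarith)]
    have key := eq_triangleWave (X := fun t => 1 - X t) (v := -v) (by fun_prop)
      (fun t => ⟨by linarith [(h01 t).2], by linarith [(h01 t).1]⟩) (by simp [h0])
      (hv.mono fun h hh => by rw [hh, h0]; ring) (fun t ht => by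
        obtain ⟨l, r, hl, hr, hc⟩ := hloc t ht
        refine ⟨-l, -r, hl.mono fun h hh => by rw [hh]; ring, hr.mono fun h hh => by rw [hh]; ring,
          ?_⟩
        rw [flip, neg_inj, neg_inj]
        exact hc)
    have h1 := key b ⟨hb.le, le_rfl⟩
    have h2 := key (b / 2) ⟨by linarith, by linarith⟩
    rw [← flip, h2, ← mul_div_assoc]
    exact triangleWave_half_mem (by rw [← h1, hb0, h0, sub_self])

end

/-! ### Straight continuation in faces and across edges. -/

noncomputable section

lemma exists_cos_sin_eq {s t : ℝ} (h : s ^ 2 + t ^ 2 = 1) : ∃ θ, cos θ = s ∧ sin θ = t := by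
  have hz : ‖(⟨s, t⟩ : ℂ)‖ = 1 := by
    rw [Complex.norm_def, Complex.normSq_mk, ← sq, ← sq, h, sqrt_one]
  have hz0 : (⟨s, t⟩ : ℂ) ≠ 0 := fun h0 => by rw [h0, norm_zero] at hz; exact zero_ne_one hz
  exact ⟨Complex.arg ⟨s, t⟩, by rw [Complex.cos_arg hz0, hz, div_one],
    by rw [Complex.sin_arg, hz, div_one]⟩

namespace Tetrahedron

variable {T : Tetrahedron} {p u w : Fin 4 → ℝ} {i j k l : Fin 4}

lemma sum_eq_zero_of_mem_directions (hp : p ∈ tetSurface) (hu : u ∈ T.directions p) :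
    ∑ a, u a = 0 := by
  obtain ⟨h, h1, h2⟩ := (hu.2.and eventually_mem_nhdsWithin).exists
  have h2 : 0 < h := h2
  have e := h1.1.2
  simp only [Pi.add_apply, Pi.smul_apply, smul_eq_mul, Finset.sum_add_distrib, ← Finset.mul_sum,
    hp.1.2] at e
  have : h * ∑ a, u a = 0 := by linarith
  exact (mul_eq_zero.1 this).resolve_left h2.ne'

lemma nonneg_of_mem_directions (hu : u ∈ T.directions p) {a : Fin 4} (ha : p a = 0) :
    0 ≤ u a := by
  obtain ⟨h, h1, h2⟩ := (hu.2.and eventually_mem_nhdsWithin).exists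
  have e := h1.1.1 a
  simp only [Pi.add_apply, Pi.smul_apply, smul_eq_mul, ha, zero_add] at e
  exact nonneg_of_mul_nonneg_right e h2

lemma eventually_pos {x : ℝ} (hx : 0 < x) (v : ℝ) : ∀ᶠ h : ℝ in 𝓝[>] 0, 0 < x + h * v := by
  have : Tendsto (fun h : ℝ => x + h * v) (𝓝 0) (𝓝 (x + 0 * v)) :=
    (by fun_prop : Continuous fun h : ℝ => x + h * v).tendsto 0
  exact (this.mono_left nhdsWithin_le_nhds).eventually (lt_mem_nhds (by simpa using hx))

/-- Coordinates positive at `p` stay positive for a short time, so a short segment can only lie in a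
face that already contains `p`. -/
lemma exists_zero_of_mem_directions (hp : p ∈ tetSurface) (hu : u ∈ T.directions p) :
    ∃ a, p a = 0 ∧ u a = 0 := by
  have : ∀ᶠ h : ℝ in 𝓝[>] 0, ∀ a, 0 < p a → 0 < p a + h * u a :=
    eventually_all.2 fun a => by
      by_cases ha : 0 < p a
      · simpa [ha] using eventually_pos ha (u a)
      · simp [ha]
  obtain ⟨h, ⟨h1, h2⟩, h3⟩ := ((hu.2.and eventually_mem_nhdsWithin).and this).exists
  obtain ⟨a, ha⟩ := h1.2
  simp only [Pi.add_apply, Pi.smul_apply, smul_eq_mul] at ha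
  have hpa : p a = 0 := by
    by_contra hne
    exact (h3 a (lt_of_le_of_ne (hp.1.1 a) (Ne.symm hne))).ne' ha
  rw [hpa, zero_add] at ha
  exact ⟨a, hpa, (mul_eq_zero.1 ha).resolve_left (ne_of_gt h2)⟩

lemma mem_directions_of (hp : p ∈ tetSurface) (h1 : ‖T.realize u‖ = 1) (hu : ∑ a, u a = 0)
    (h0 : ∀ a, p a = 0 → 0 ≤ u a) (hz : ∃ a, p a = 0 ∧ u a = 0) : u ∈ T.directions p := by
  refine ⟨h1, ?_⟩
  have : ∀ᶠ h : ℝ in 𝓝[>] 0, ∀ a, 0 < p a → 0 < p a + h * u a :=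
    eventually_all.2 fun a => by
      by_cases ha : 0 < p a
      · simpa [ha] using eventually_pos ha (u a)
      · simp [ha]
  filter_upwards [this, eventually_mem_nhdsWithin] with h h2 h3
  have h3 : 0 < h := h3
  refine ⟨⟨fun a => ?_, ?_⟩, ?_⟩
  · simp only [Pi.add_apply, Pi.smul_apply, smul_eq_mul]
    rcases (hp.1.1 a).eq_or_lt with ha | ha
    · rw [← ha, zero_add]; exact mul_nonneg h3.le (h0 a ha.symm)
    · exact (h2 a ha).le
  · simp [Finset.sum_add_distrib, ← Finset.mul_sum, hu, hp.1.2]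
  · obtain ⟨a, ha, ha'⟩ := hz
    exact ⟨a, by simp [ha, ha']⟩

/-- An orthonormal frame of the plane of a face, with first vector along an edge and with second
vector pointing into the face. -/
lemma exists_face_basis (T : Tetrahedron) (h : [i, j, k, l].Nodup) :
    ∃ E F : Fin 4 → ℝ, ‖T.realize E‖ = 1 ∧ ‖T.realize F‖ = 1 ∧
      inner ℝ (T.realize E) (T.realize F) = 0 ∧ ∑ a, E a = 0 ∧ ∑ a, F a = 0 ∧
      E i = 0 ∧ E j = 0 ∧ E l = -E k ∧ 0 < F i ∧ F j = 0 ∧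
      ∀ u : Fin 4 → ℝ, ∑ a, u a = 0 → u j = 0 → ‖T.realize u‖ = 1 →
        ∃ θ, u = cos θ • E + sin θ • F := by
  have hne := h
  simp only [List.nodup_cons, List.mem_cons, List.not_mem_nil, not_or, or_false] at hne
  obtain ⟨⟨hij, hik, hil⟩, ⟨hjk, hjl⟩, hkl, -⟩ := hne
  have pos : ∀ v : Fin 4 → ℝ, v j = 0 → ∑ a, v a = 0 → (∃ a, v a ≠ 0) → 0 < ‖T.realize v‖ := by
    rintro v hv hs ⟨a, ha⟩
    exact norm_pos_iff.2 fun h0 => ha (by rw [T.eq_zero_of_realize_eq_zero v j hv hs h0]; rfl)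
  have unit : ∀ v : Fin 4 → ℝ, 0 < ‖T.realize v‖ →
      ‖T.realize (‖T.realize v‖⁻¹ • v)‖ = 1 := fun v hv => by
    rw [realize_smul, norm_smul, norm_inv, norm_norm, inv_mul_cancel₀ hv.ne']
  obtain ⟨e, he⟩ : ∃ e : Fin 4 → ℝ, e = Pi.single k 1 - Pi.single l 1 := ⟨_, rfl⟩
  have hes : ∑ a, e a = 0 := by simp [he, Finset.sum_sub_distrib]
  have ei : e i = 0 := by simp [he, hik, hil]
  have ej : e j = 0 := by simp [he, hjk, hjl]
  have ek : e k = 1 := by simp [he, hkl]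
  have el : e l = -1 := by simp [he, Ne.symm hkl]
  have hep := pos e ej hes ⟨k, by simp [ek]⟩
  obtain ⟨E, hE⟩ : ∃ E, E = ‖T.realize e‖⁻¹ • e := ⟨_, rfl⟩
  have hE1 : ‖T.realize E‖ = 1 := hE ▸ unit e hep
  have Es : ∑ a, E a = 0 := by simp [hE, ← Finset.mul_sum, hes]
  have Ei : E i = 0 := by simp [hE, ei]
  have Ej : E j = 0 := by simp [hE, ej]
  have Ek : 0 < E k := by simp only [hE, Pi.smul_apply, ek, smul_eq_mul]; positivity
  have El : E l = -E k := by simp [hE, ek, el]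
  obtain ⟨f, hf⟩ : ∃ f : Fin 4 → ℝ, f = Pi.single i 1 - Pi.single l 1 := ⟨_, rfl⟩
  -- Gram–Schmidt in the face opposite `j`. Since `E i = 0`, the `i`-th coordinate stays `1`, so the
  -- result points into the face.
  obtain ⟨g, hg⟩ : ∃ g, g = f - (inner ℝ (T.realize E) (T.realize f) : ℝ) • E := ⟨_, rfl⟩
  have gs : ∑ a, g a = 0 := by
    simp [hg, hf, Finset.sum_sub_distrib, ← Finset.mul_sum, Es]
  have gi : g i = 1 := by simp [hg, hf, Ei, hil]
  have gj : g j = 0 := by simp [hg, hf, Ej, Ne.symm hij, hjl]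
  have hgp := pos g gj gs ⟨i, by simp [gi]⟩
  have hEg : inner ℝ (T.realize E) (T.realize g) = 0 := by
    rw [hg, realize_sub, realize_smul, inner_sub_right, real_inner_smul_right,
      real_inner_self_eq_norm_sq, hE1]
    ring
  obtain ⟨F, hF⟩ : ∃ F, F = ‖T.realize g‖⁻¹ • g := ⟨_, rfl⟩
  have hF1 : ‖T.realize F‖ = 1 := hF ▸ unit g hgp
  have Fs : ∑ a, F a = 0 := by simp [hF, ← Finset.mul_sum, gs]
  have Fi : 0 < F i := by simp only [hF, Pi.smul_apply, gi, smul_eq_mul]; positivity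
  have Fj : F j = 0 := by simp [hF, gj]
  have hEF : inner ℝ (T.realize E) (T.realize F) = 0 := by
    rw [hF, realize_smul, real_inner_smul_right, hEg, mul_zero]
  refine ⟨E, F, hE1, hF1, hEF, Es, Fs, Ei, Ej, El, Fi, Fj, fun u us uj u1 => ?_⟩
  -- The coefficients are read off from coordinates `i` and `k`; coordinate `l` then follows from
  -- the zero sum.
  obtain ⟨t, ht⟩ : ∃ t, t = u i / F i := ⟨_, rfl⟩
  obtain ⟨s, hs⟩ : ∃ s, s = (u k - t * F k) / E k := ⟨_, rfl⟩
  have hti : t * F i = u i := by rw [ht, div_mul_cancel₀ _ Fi.ne']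
  have hsk : s * E k = u k - t * F k := by rw [hs, div_mul_cancel₀ _ Ek.ne']
  have hdec : u = s • E + t • F := by
    rw [sum_eq_of_distinct _ h] at us Fs
    funext a
    have ha : a = i ∨ a = j ∨ a = k ∨ a = l := by
      clear * - h; revert a i j k l; decide
    simp only [Pi.add_apply, Pi.smul_apply, smul_eq_mul]
    rcases ha with rfl | rfl | rfl | rfl
    · rw [Ei, hti]; ring
    · rw [Ej, uj, Fj]; ring
    · rw [hsk]; ring
    · rw [El, mul_neg, hsk]
      have : F a = -(F i + F j + F k) := by linarith
      rw [this, Fj]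
      linarith
  have hst : s ^ 2 + t ^ 2 = 1 := by
    have e1 : ‖T.realize u‖ ^ 2 = s ^ 2 + t ^ 2 := by
      rw [hdec, realize_add, realize_smul, realize_smul, norm_add_sq_real, norm_smul, norm_smul,
        hE1, hF1, real_inner_smul_left, real_inner_smul_right, hEF]
      simp
    rw [← e1, u1, one_pow]
  obtain ⟨θ, rfl, rfl⟩ := exists_cos_sin_eq hst
  exact ⟨θ, hdec⟩

lemma norm_realize_cos_add_sin {E F : Fin 4 → ℝ} (hE : ‖T.realize E‖ = 1) (hF : ‖T.realize F‖ = 1)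
    (hEF : inner ℝ (T.realize E) (T.realize F) = 0) (θ : ℝ) :
    ‖T.realize (cos θ • E + sin θ • F)‖ = 1 := by
  have : ‖T.realize (cos θ • E + sin θ • F)‖ ^ 2 = 1 := by
    rw [realize_add, realize_smul, realize_smul, norm_add_sq_real, norm_smul, norm_smul,
        hE, hF, real_inner_smul_left, real_inner_smul_right, hEF]
    simp
  exact (pow_eq_one_iff_of_nonneg (norm_nonneg _) two_ne_zero).1 this

/-- Inside a face, a path with at most `π` on either side goes straight on. -/
lemma straight_of_face (hp : p ∈ tetSurface) (h : [i, j, k, l].Nodup) (hj : p j = 0)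
    (hz : ∀ a, p a = 0 → a = j) (hu : u ∈ T.directions p) (hw : w ∈ T.directions p)
    (hs : T.SideAnglesLePi p u w) : w = -u := by
  obtain ⟨E, F, hE, hF, hEF, Es, Fs, Ei, Ej, El, Fi, Fj, hdec⟩ := T.exists_face_basis h
  -- With `G = -F` there is no bend, and the circle is the ordinary unit circle of the face.
  have hD : ∀ θ, bentCircle E F (-F) θ = cos θ • E + sin θ • F := fun θ => by
    rcases le_total 0 (sin θ) with h0 | h0
    · exact bentCircle_of_nonneg _ _ _ h0
    · rw [bentCircle_of_nonpos _ _ _ h0, smul_neg, neg_smul, neg_neg]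
  have fr : T.IsFrame p E F (-F) := by
    refine ⟨hE, hF, by rwa [realize_neg, norm_neg], hEF, by rw [realize_neg, inner_neg_right, hEF,
      neg_zero], fun θ => ?_, fun v hv => ?_, fun θ φ e => ?_⟩
    · rw [hD]
      have hDj : (cos θ • E + sin θ • F) j = 0 := by simp [Ej, Fj]
      refine mem_directions_of hp (norm_realize_cos_add_sin hE hF hEF θ) ?_ ?_ ⟨j, hj, hDj⟩
      · simp [Finset.sum_add_distrib, ← Finset.mul_sum, Es, Fs]
      · intro a ha; rw [hz a ha, hDj]
    · obtain ⟨a, ha, ha'⟩ := exists_zero_of_mem_directions hp hv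
      rw [hz a ha] at ha'
      obtain ⟨θ, hθ⟩ := hdec v (sum_eq_zero_of_mem_directions hp hv) ha' hv.1
      exact ⟨θ, by rw [hD, hθ]⟩
    · rw [hD, hD] at e
      have e' := congrArg T.realize e
      simp only [realize_add, realize_smul] at e'
      constructor
      · have := congrArg (inner ℝ (T.realize E)) e'
        simpa [inner_add_right, real_inner_smul_right, hEF, hE, real_inner_self_eq_norm_sq]
          using this
      · have := congrArg (inner ℝ (T.realize F)) e'
        simpa [inner_add_right, real_inner_smul_right, hEF, hF, real_inner_self_eq_norm_sq,
          real_inner_comm (T.realize E)] using this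
  obtain ⟨θ, rfl, rfl⟩ := fr.straight hu hw hs
  simp only [bentCircle, smul_neg]; abel

/-- At an edge of an isosceles tetrahedron, a path with at most `π` on either side leaves in the
direction from which the half-turn around the midpoint of the edge takes its arrival. -/
lemma straight_of_edge (hT : T.IsIsosceles) (hp : p ∈ tetSurface) (h : [i, j, k, l].Nodup)
    (hi : p i = 0) (hj : p j = 0) (hz : ∀ a, p a = 0 → a = i ∨ a = j)
    (hu : u ∈ T.directions p) (hw : w ∈ T.directions p)
    (hs : T.SideAnglesLePi p u w) : w i = u j ∧ w j = u i ∧ w k = u l ∧ w l = u k := by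
  obtain ⟨E, F, hE, hF, hEF, Es, Fs, Ei, Ej, El, Fi, Fj, hdec⟩ := T.exists_face_basis h
  have hcov : ∀ a, a = i ∨ a = j ∨ a = k ∨ a = l := by
    intro a; clear * - h; revert a i j k l; decide
  have hne := h
  simp only [List.nodup_cons, List.mem_cons, List.not_mem_nil, not_or, or_false] at hne
  obtain ⟨⟨hij, hik, hil⟩, ⟨hjk, hjl⟩, hkl, -⟩ := hne
  -- The half-turn about the midpoint of the edge `kl`, which contains `p`. It exchanges the two
  -- faces at that edge, so `F ∘ τ` serves as the inward normal of the second face.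
  obtain ⟨τ, ti, tj, tk, tl⟩ : ∃ τ : Fin 4 → Fin 4, τ i = j ∧ τ j = i ∧ τ k = l ∧ τ l = k := by
    refine ⟨fun a => if a = i then j else if a = j then i else if a = k then l else k, ?_⟩
    simp [Ne.symm hij, Ne.symm hik, Ne.symm hil, Ne.symm hjk, Ne.symm hjl, Ne.symm hkl]
  have tt : ∀ v : Fin 4 → ℝ, (v ∘ τ) ∘ τ = v := fun v => by
    funext a
    rcases hcov a with rfl | rfl | rfl | rfl <;> simp [ti, tj, tk, tl]
  have tE : E ∘ τ = -E := by
    funext a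
    rcases hcov a with rfl | rfl | rfl | rfl <;> simp [ti, tj, tk, tl, Ei, Ej, El]
  have ts : ∀ v : Fin 4 → ℝ, ∑ a, v a = 0 → ∑ a, (v ∘ τ) a = 0 := fun v hv => by
    rw [sum_eq_of_distinct _ h] at hv ⊢
    simp only [Function.comp, ti, tj, tk, tl]; linarith
  have tn : ∀ v : Fin 4 → ℝ, ∑ a, v a = 0 → ‖T.realize (v ∘ τ)‖ = ‖T.realize v‖ := fun v hv =>
    norm_realize_comp_swap hT v (v ∘ τ) h hv (by simp [ti]) (by simp [tj]) (by simp [tk])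
      (by simp [tl])
  have hG : ‖T.realize (F ∘ τ)‖ = 1 := by rw [tn F Fs, hF]
  -- Polarization: the half-turn takes `F + E` to `F ∘ τ - E` and preserves its length.
  have hEG : inner ℝ (T.realize E) (T.realize (F ∘ τ)) = 0 := by
    have h1 := tn (F + E) (by simp [Finset.sum_add_distrib, Es, Fs])
    have h2 : (F + E) ∘ τ = F ∘ τ - E := by
      rw [sub_eq_add_neg, ← tE]; rfl
    have h3 := norm_sub_sq_real (T.realize (F ∘ τ)) (T.realize E)
    have h4 := norm_add_sq_real (T.realize F) (T.realize E)
    rw [← realize_sub, ← h2, h1, realize_add, h4, hG, hF, real_inner_comm, hEF,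
      real_inner_comm (T.realize E)] at h3
    linarith
  have Dcomp : ∀ θ, bentCircle E F (F ∘ τ) θ ∘ τ = bentCircle (-E) (F ∘ τ) F θ := fun θ => by
    have e1 : bentCircle E F (F ∘ τ) θ ∘ τ
        = cos θ • (E ∘ τ) + max (sin θ) 0 • (F ∘ τ) + max (-sin θ) 0 • ((F ∘ τ) ∘ τ) := rfl
    rw [e1, tE, tt]; rfl
  have Di : ∀ θ, bentCircle E F (F ∘ τ) θ i = max (sin θ) 0 * F i := fun θ => by
    simp [bentCircle, Ei, ti, Fj]
  have Dj : ∀ θ, bentCircle E F (F ∘ τ) θ j = max (-sin θ) 0 * F i := fun θ => by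
    simp [bentCircle, Ej, tj, Fj]
  have fr : T.IsFrame p E F (F ∘ τ) := by
    refine ⟨hE, hF, hG, hEF, hEG, fun θ => ?_, fun v hv => ?_, fun θ φ e => ?_⟩
    · refine mem_directions_of hp ?_ ?_ ?_ ?_
      · rcases le_total 0 (sin θ) with h0 | h0
        · rw [bentCircle_of_nonneg _ _ _ h0]; exact norm_realize_cos_add_sin hE hF hEF θ
        · rw [bentCircle_of_nonpos _ _ _ h0]
          simpa using norm_realize_cos_add_sin hE hG hEG (-θ)
      · simp only [bentCircle, Pi.add_apply, Pi.smul_apply, smul_eq_mul, Finset.sum_add_distrib,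
          ← Finset.mul_sum, Es, Fs, ts F Fs, mul_zero, add_zero]
      · intro a ha
        rcases hz a ha with rfl | rfl
        · rw [Di]; exact mul_nonneg (le_max_right _ _) Fi.le
        · rw [Dj]; exact mul_nonneg (le_max_right _ _) Fi.le
      · rcases le_total 0 (sin θ) with h0 | h0
        · exact ⟨j, hj, by rw [Dj, max_eq_right (by linarith), zero_mul]⟩
        · exact ⟨i, hi, by rw [Di, max_eq_right h0, zero_mul]⟩
    · have vs := sum_eq_zero_of_mem_directions hp hv
      have face : ∀ v' : Fin 4 → ℝ, ∑ a, v' a = 0 → v' j = 0 → 0 ≤ v' i → ‖T.realize v'‖ = 1 →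
          ∃ θ, v' = bentCircle E F (F ∘ τ) θ := fun v' hs' hj' hi' h1' => by
        obtain ⟨θ, hθ⟩ := hdec v' hs' hj' h1'
        have : 0 ≤ sin θ := by
          rw [hθ] at hi'
          simp only [Pi.add_apply, Pi.smul_apply, smul_eq_mul, Ei, mul_zero, zero_add] at hi'
          exact nonneg_of_mul_nonneg_left hi' Fi
        exact ⟨θ, by rw [bentCircle_of_nonneg _ _ _ this, hθ]⟩
      obtain ⟨a, ha, ha'⟩ := exists_zero_of_mem_directions hp hv
      rcases hz a ha with rfl | rfl
      -- A direction into the second face is carried by the half-turn into the first; advancing the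
      -- parameter by `π` undoes this.
      · obtain ⟨θ, hθ⟩ := face (v ∘ τ) (ts v vs) (by simp [tj, ha'])
          (by simpa [ti] using nonneg_of_mem_directions hv hj) (by rw [tn v vs, hv.1])
        refine ⟨θ + π, ?_⟩
        rw [bentCircle_add_pi, ← Dcomp, ← hθ, tt]
      · exact face v vs ha' (nonneg_of_mem_directions hv hi) hv.1
    · have hi' := congrFun e i
      have hj' := congrFun e j
      rw [Di, Di] at hi'
      rw [Dj, Dj] at hj'
      have h1 := mul_right_cancel₀ Fi.ne' hi'
      have h2 := mul_right_cancel₀ Fi.ne' hj'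
      have h3 : sin θ = sin φ := by
        have key : ∀ x : ℝ, x = max x 0 - max (-x) 0 := fun x => by
          rcases le_total 0 x with h0 | h0
          · rw [max_eq_left h0, max_eq_right (by linarith), sub_zero]
          · rw [max_eq_right h0, max_eq_left (by linarith), zero_sub, neg_neg]
        rw [key (sin θ), key (sin φ), h1, h2]
      refine ⟨?_, h3⟩
      have e' : cos θ • E = cos φ • E := by
        simpa [bentCircle, h3] using e
      have e'' := congrArg (fun v => inner ℝ (T.realize E) (T.realize v)) e'
      simpa [realize_smul, real_inner_smul_right, real_inner_self_eq_norm_sq, hE] using e''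
  obtain ⟨θ, rfl, rfl⟩ := fr.straight hu hw hs
  rw [← Dcomp]
  simp [ti, tj, tk, tl]

lemma exists_distinct (a b : Fin 4) (h : a ≠ b) : ∃ c d, [a, b, c, d].Nodup := by
  revert a b; decide

/-- Away from the vertices, the sum of two barycentric coordinates changes linearly along a path with
at most `π` on either side, except that it is reflected at the values `0` and `1`. -/
lemma reflect_of_sideAnglesLePi (hT : T.IsIsosceles) (hp : p ∈ tetSurface)
    (hv : ∀ a, p ≠ surfaceVertex a) (hu : u ∈ T.directions p) (hw : w ∈ T.directions p)
    (hs : T.SideAnglesLePi p u w) {a b : Fin 4} (hab : a ≠ b) :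
    p a + p b ∈ ({0, 1} : Set ℝ) ∧ w a + w b = u a + u b ∨
    p a + p b ∉ ({0, 1} : Set ℝ) ∧ w a + w b = -(u a + u b) := by
  have hnn := hp.1.1
  by_cases hedge : ∃ i j, i ≠ j ∧ p i = 0 ∧ p j = 0
  · obtain ⟨i, j, hij, hi, hj⟩ := hedge
    obtain ⟨k, l, h⟩ := exists_distinct i j hij
    have hcov : ∀ a, a = i ∨ a = j ∨ a = k ∨ a = l := by
      intro a; clear * - h; revert a i j k l; decide
    have hsum := hp.1.2
    have hus := sum_eq_zero_of_mem_directions hp hu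
    rw [sum_eq_of_distinct _ h] at hsum hus
    have vert : ∀ c, (∀ d, d ≠ c → p d = 0) → p = surfaceVertex c := fun c hc => by
      have h1 : ∑ d, p d = p c := Fintype.sum_eq_single c hc
      funext d
      by_cases hd : d = c
      · rw [hd, surfaceVertex, Pi.single_eq_same, ← h1, hp.1.2]
      · rw [hc d hd, surfaceVertex, Pi.single_eq_of_ne hd]
    have hk : 0 < p k := lt_of_le_of_ne (hnn k) fun h0 => hv l (vert l fun d hd => by
      rcases hcov d with rfl | rfl | rfl | rfl
      exacts [hi, hj, h0.symm, absurd rfl hd])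
    have hl : 0 < p l := lt_of_le_of_ne (hnn l) fun h0 => hv k (vert k fun d hd => by
      rcases hcov d with rfl | rfl | rfl | rfl
      exacts [hi, hj, absurd rfl hd, h0.symm])
    obtain ⟨e1, e2, e3, e4⟩ := straight_of_edge hT hp h hi hj (fun a ha => by
      rcases hcov a with rfl | rfl | rfl | rfl
      exacts [Or.inl rfl, Or.inr rfl, absurd ha hk.ne', absurd ha hl.ne']) hu hw hs
    simp only [mem_insert_iff, mem_singleton_iff, not_or]
    -- On the edge `kl` the pair `ij` has sum `0` and `kl` has sum `1`, and the half-turn keeps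
    -- their rates. Every mixed pair has sum strictly between and is exchanged with its complement,
    -- which negates the rate because all rates add up to `0`.
    rcases hcov a with rfl | rfl | rfl | rfl <;> rcases hcov b with rfl | rfl | rfl | rfl <;> first
      | exact absurd rfl hab
      | exact Or.inl ⟨Or.inl (by linarith), by linarith⟩
      | exact Or.inl ⟨Or.inr (by linarith), by linarith⟩
      | exact Or.inr ⟨⟨fun _ => by linarith, fun _ => by linarith⟩, by linarith⟩
  · obtain ⟨j, hj⟩ := hp.2
    have hz : ∀ c d, p c = 0 → p d = 0 → c = d := fun c d hc hd => by
      by_contra hne; exact hedge ⟨c, d, hne, hc, hd⟩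
    obtain ⟨i, k, l, h⟩ : ∃ i k l, [i, j, k, l].Nodup := by
      clear * -; revert j; decide
    obtain rfl := straight_of_face hp h hj (fun a ha => hz a j ha hj) hu hw hs
    -- Inside a face only one coordinate vanishes, whereas a pair sum of `0` or `1` would force two
    -- zeros, in the pair or in its complement.
    refine Or.inr ⟨?_, by simp only [Pi.neg_apply]; ring⟩
    obtain ⟨c, d, hcd⟩ := exists_distinct a b hab
    have hsum := hp.1.2
    rw [sum_eq_of_distinct _ hcd] at hsum
    have hne : c ≠ d := by
      simp only [List.nodup_cons, List.mem_cons] at hcd; tauto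
    rintro (h0 | h0)
    · exact hab (hz a b (by linarith [hnn a, hnn b]) (by linarith [hnn a, hnn b]))
    · rw [mem_singleton_iff] at h0
      exact hne (hz c d (by linarith [hnn c, hnn d]) (by linarith [hnn c, hnn d]))

end Tetrahedron

/-- A surface point is a vertex if the sums of any two of its barycentric coordinates are integers. -/
lemma eq_surfaceVertex_of_pair_sums {p : Fin 4 → ℝ} (hp : p ∈ stdSimplex ℝ (Fin 4))
    (h : ∀ a b, a ≠ b → p a + p b ∈ ({0, 1} : Set ℝ)) : ∃ i, p = surfaceVertex i := by
  have h1 := h 1 3 (by decide)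
  have h2 := h 2 3 (by decide)
  have h3 := h 1 2 (by decide)
  have hs := hp.2
  rw [Fin.sum_univ_four] at hs
  have n0 := hp.1 0
  have n1 := hp.1 1
  have n2 := hp.1 2
  have n3 := hp.1 3
  have mk : ∀ x y z t : ℝ, p 0 = x → p 1 = y → p 2 = z → p 3 = t → p = ![x, y, z, t] :=
    fun x y z t h0 h1 h2 h3 => by
      funext a; fin_cases a <;> simp [h0, h1, h2, h3]
  have v0 : surfaceVertex 0 = ![1, 0, 0, 0] := by
    funext a; fin_cases a <;> simp [surfaceVertex]
  have v1 : surfaceVertex 1 = ![0, 1, 0, 0] := by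
    funext a; fin_cases a <;> simp [surfaceVertex]
  have v2 : surfaceVertex 2 = ![0, 0, 1, 0] := by
    funext a; fin_cases a <;> simp [surfaceVertex]
  have v3 : surfaceVertex 3 = ![0, 0, 0, 1] := by
    funext a; fin_cases a <;> simp [surfaceVertex]
  simp only [mem_insert_iff, mem_singleton_iff] at h1 h2 h3
  -- The three sums determine the point. Exactly one sum equal to `1` would give a coordinate
  -- `-1/2`, and three would give a total above `1`; the other four cases are the vertices.
  rcases h1 with h1 | h1 <;> rcases h2 with h2 | h2 <;> rcases h3 with h3 | h3 <;> first
    | (exfalso; linarith)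
    | exact ⟨0, v0 ▸ mk _ _ _ _ (by linarith) (by linarith) (by linarith) (by linarith)⟩
    | exact ⟨1, v1 ▸ mk _ _ _ _ (by linarith) (by linarith) (by linarith) (by linarith)⟩
    | exact ⟨2, v2 ▸ mk _ _ _ _ (by linarith) (by linarith) (by linarith) (by linarith)⟩
    | exact ⟨3, v3 ▸ mk _ _ _ _ (by linarith) (by linarith) (by linarith) (by linarith)⟩

/-! ### The loop from a vertex back to itself. -/

namespace Tetrahedron.IsClosedQuasigeodesic

variable {T : Tetrahedron} {L : ℝ} {γ : ℝ → Fin 4 → ℝ}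

lemma continuous (h : T.IsClosedQuasigeodesic L γ) : Continuous γ := by
  refine continuous_iff_continuousAt.2 fun s => ?_
  obtain ⟨u, -, w, -, hu, hw, -⟩ := h.quasi s
  have lim : ∀ v : Fin 4 → ℝ, Tendsto (fun h : ℝ => γ s + h • v) (𝓝[>] 0) (𝓝 (γ s)) := fun v => by
    have : Tendsto (fun h : ℝ => γ s + h • v) (𝓝 0) (𝓝 (γ s + (0 : ℝ) • v)) :=
      (by fun_prop : Continuous fun h : ℝ => γ s + h • v).tendsto 0
    rw [zero_smul, add_zero] at this
    exact this.mono_left nhdsWithin_le_nhds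
  have hl : Tendsto γ (𝓝[<] s) (𝓝 (γ s)) := by
    have h1 : Tendsto (fun t => s - t) (𝓝[<] s) (𝓝[>] 0) := by
      refine tendsto_nhdsWithin_iff.2 ⟨?_, eventually_mem_nhdsWithin.mono fun t ht =>
        sub_pos.2 (mem_Iio.1 ht)⟩
      have : Tendsto (fun t => s - t) (𝓝 s) (𝓝 (s - s)) :=
        (by fun_prop : Continuous fun t : ℝ => s - t).tendsto s
      rw [sub_self] at this
      exact this.mono_left nhdsWithin_le_nhds
    have h2 := ((lim u).congr' (hu.mono fun _ e => e.symm)).comp h1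
    simpa [Function.comp_def] using h2
  have hr : Tendsto γ (𝓝[>] s) (𝓝 (γ s)) := by
    have h1 : Tendsto (fun t => t - s) (𝓝[>] s) (𝓝[>] 0) := by
      refine tendsto_nhdsWithin_iff.2 ⟨?_, eventually_mem_nhdsWithin.mono fun t ht =>
        sub_pos.2 (mem_Ioi.1 ht)⟩
      have : Tendsto (fun t => t - s) (𝓝 s) (𝓝 (s - s)) :=
        (by fun_prop : Continuous fun t : ℝ => t - s).tendsto s
      rw [sub_self] at this
      exact this.mono_left nhdsWithin_le_nhds
    have h2 := ((lim w).congr' (hw.mono fun _ e => e.symm)).comp h1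
    simpa [Function.comp_def] using h2
  exact continuousAt_iff_continuous_left'_right'.2 ⟨hl, hr⟩

/-- A closed curve that starts at the point `γ s` returns to it for a first time. -/
lemma exists_first_return (h : T.IsClosedQuasigeodesic L γ) (s : ℝ) :
    ∃ b > 0, γ (s + b) = γ s ∧ ∀ t ∈ Ioo 0 b, γ (s + t) ≠ γ s := by
  obtain ⟨-, -, w, hwd, -, hw, -⟩ := h.quasi s
  have hw0 : w ≠ 0 := by
    rintro rfl
    have := hwd.1
    simp [realize] at this
  have hne : ∀ᶠ t : ℝ in 𝓝[>] 0, γ (s + t) ≠ γ s := by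
    filter_upwards [hw, eventually_mem_nhdsWithin] with t ht ht0 e
    rw [ht, add_eq_left, smul_eq_zero] at e
    exact e.elim (ne_of_gt ht0) hw0
  -- The curve leaves its starting point along a segment, so return times are at least `d`; they
  -- form a closed set, and its infimum is a positive return time.
  obtain ⟨d, hd, hd'⟩ := mem_nhdsGT_iff_exists_Ioo_subset.1 hne
  have hd : 0 < d := hd
  let V : Set ℝ := {t | d ≤ t ∧ γ (s + t) = γ s}
  have hLV : L ∈ V := ⟨not_lt.1 fun hlt => hd' ⟨h.length_pos, hlt⟩ (h.periodic s), h.periodic s⟩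
  have hVc : IsClosed V := by
    have := h.continuous
    exact isClosed_Ici.inter (isClosed_eq (by fun_prop) continuous_const)
  have hVb : BddBelow V := ⟨d, fun t ht => ht.1⟩
  obtain ⟨h1, h2⟩ := hVc.csInf_mem ⟨L, hLV⟩ hVb
  refine ⟨sInf V, hd.trans_le h1, h2, fun t ht e => ?_⟩
  rcases lt_or_ge t d with htd | htd
  · exact hd' ⟨ht.1, htd⟩ e
  · exact absurd (csInf_le hVb ⟨htd, e⟩) (not_le.2 ht.2)

/-- A closed quasigeodesic through one vertex of an isosceles tetrahedron passes through another. -/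
lemma exists_ne_vertex (hT : T.IsIsosceles) (h : T.IsClosedQuasigeodesic L γ) {i : Fin 4}
    (hi : surfaceVertex i ∈ range γ) : ∃ j ≠ i, surfaceVertex j ∈ range γ := by
  by_contra! hno
  obtain ⟨s, hs⟩ := hi
  obtain ⟨b, hb, hb1, hb2⟩ := h.exists_first_return s
  have hnv : ∀ t ∈ Ioo 0 b, ∀ a, γ (s + t) ≠ surfaceVertex a := fun t ht a e => by
    by_cases ha : a = i
    · exact hb2 t ht (by rw [e, hs, ha])
    · exact hno a ha ⟨_, e⟩
  have hmem : b / 2 ∈ Ioo 0 b := ⟨by linarith, by linarith⟩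
  -- On `(0, b)` no vertex is met: `i` because `b` is the first return, the others by assumption.
  -- Each pair sum is thus a reflected motion there, and the midpoint comes out as a vertex, a
  -- contradiction.
  obtain ⟨a, ha⟩ := eq_surfaceVertex_of_pair_sums (h.mem_surface (s + b / 2)).1 fun a c hac => by
    obtain ⟨e, f, hd⟩ := Tetrahedron.exists_distinct a c hac
    have hc := h.continuous
    obtain ⟨-, -, w, -, -, hw, -⟩ := h.quasi s
    refine midpoint_mem_of_reflected (X := fun t => γ (s + t) a + γ (s + t) c) (v := w a + w c) hb
      (by fun_prop) (fun t => ?_) ?_ (by simp only [hb1, add_zero]) ?_ fun t ht => ?_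
    · have hp := (h.mem_surface (s + t)).1
      have hsum := hp.2
      rw [Tetrahedron.sum_eq_of_distinct _ hd] at hsum
      exact ⟨add_nonneg (hp.1 a) (hp.1 c), by linarith [hp.1 e, hp.1 f]⟩
    · simp only [add_zero, hs, surfaceVertex, Pi.single_apply]
      by_cases h1 : a = i
      · have h2 : c ≠ i := fun h2 => hac (h1.trans h2.symm)
        simp [h1, h2]
      · by_cases h2 : c = i <;> simp [h1, h2]
    · filter_upwards [hw] with x hx
      simp only [hx, add_zero, Pi.add_apply, Pi.smul_apply, smul_eq_mul]; ring
    · obtain ⟨u, hu, w, hw, hul, hwl, hq⟩ := h.quasi (s + t)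
      refine ⟨u a + u c, w a + w c, ?_, ?_, Tetrahedron.reflect_of_sideAnglesLePi hT
        (h.mem_surface _) (hnv t ht) hu hw hq hac⟩
      · filter_upwards [hul] with x hx
        rw [← add_sub_assoc, hx]
        simp only [Pi.add_apply, Pi.smul_apply, smul_eq_mul]; ring
      · filter_upwards [hwl] with x hx
        rw [← add_assoc, hx]
        simp only [Pi.add_apply, Pi.smul_apply, smul_eq_mul]; ring
  exact hnv _ hmem a ha

end Tetrahedron.IsClosedQuasigeodesic

end

theorem mainTheorem2 (T : Tetrahedron) (hT : T.IsIsosceles) :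
    ¬ ∃ (L : ℝ) (γ : ℝ → Fin 4 → ℝ), T.IsSimpleClosedQuasigeodesicThrough 1 L γ := by
  rintro ⟨L, γ, hq, -, hcard⟩
  obtain ⟨i, hi⟩ := Set.ncard_eq_one.1 hcard
  obtain ⟨j, hji, hj⟩ := hq.exists_ne_vertex hT (hi.ge (mem_singleton i))
  exact hji (hi.le hj)
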